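/- Let $\mathbb{D}$ be the set of dyadic rationals. Each $d\in\mathbb{D}$ is written as a binary numeral in lowest form over the alphabet $\{0,1,-,.\}$ (an optional minus sign, the integer part without superfluous leading zeros, and, for non-integers, a point and the fractional digits without trailing zeros), and is encoded as a binary string $\tau^*(d)$ by replacing the symbols by $0\mapsto 00$, $1\mapsto 11$, $-\mapsto 01$, $.\mapsto 10$. For $a\in\mathbb{D}$, a function $f\colon[a,\infty)\cap\mathbb{D}\to\mathbb{D}$ is \emph{polynomial time computable} if there are a Turing machine $M$ and a polynomial $p$ such that for every dyadic $d\ge a$ the machine $M$ on input $\tau^*(d)$ outputs $\tau^*(f(d))$ in at most $p(|\tau^*(d)|)$ steps. A \emph{modulus of continuity} of $f$ is a function $m\colon\mathbb{N}^2\to\mathbb{N}$ such that for all $k,n\in\mathbb{N}$ and all dyadic $x,y\in[a,a+2^k]$, if $|x-y|\le 2^{-m(k,n)}$ then $|f(x)-f(y)|\le 2^{-n}$; $f$ is \emph{continuous} if it has a modulus of continuity. Theorem. There exist $a\in\mathbb{D}$ and a continuous, polynomial time computable function $f\colon[a,\infty)\cap\mathbb{D}\to\mathbb{D}$ such that no modulus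 of continuity of $f$ is polynomial in the extension parameter $k$ or in the precision parameter $n$ when the other is held constant. Precisely, for every modulus of continuity $m$ of $f$: for every fixed $n$, the function $k\mapsto m(k,n)$ is not bounded by any polynomial in $k$; and for every fixed $k$, the function $n\mapsto m(k,n)$ is not bounded by any polynomial in $n$. -/

import Mathlib

/-! Polynomial time computability and moduli of continuity for functions on dyadic rays.
The dyadic rationals are the type `Dyadic`; `Dyadic.toRat` is the inclusion into `ℚ`. -/

namespace DyadicComplexity

/-- The alphabet `{0, 1, -, .}` in which dyadic numbers are written. -/
inductive Sym where
  | zero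
  | one
  | minus
  | point

/-- The binary code of a symbol: `0 ↦ 00`, `1 ↦ 11`, `- ↦ 01`, `. ↦ 10`. -/
def Sym.code : Sym → List Bool
  | .zero => [false, false]
  | .one => [true, true]
  | .minus => [false, true]
  | .point => [true, false]

/-- The digit of a bit. -/
def Sym.ofBit : Bool → Sym
  | false => .zero
  | true => .one

/-- The binary digits of a natural number, most significant digit first, without leading zeros
(the number `0` is written `0`). -/
def natBits (n : ℕ) : List Bool :=
  if n = 0 then [false] else n.bits.reverse

/-- The `e` lowest binary digits of `m`, most significant digit first: the digits after the
point of `m / 2 ^ e` when `m < 2 ^ e`. -/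
def fracBits (e m : ℕ) : List Bool :=
  (List.range e).reverse.map m.testBit

/-- The binary numeral of a dyadic number in lowest form: a minus sign if the number is negative,
the binary expansion of the integer part of its absolute value and, if the number is not an
integer, the point followed by the digits of the fractional part. As `d.toRat` is a reduced
fraction, with denominator `2 ^ e`, the fractional part has exactly `e` digits and no
trailing zeros. -/
def numeral (d : Dyadic) : List Sym :=
  (if d.toRat < 0 then [Sym.minus] else []) ++
  (natBits (d.toRat.num.natAbs / d.toRat.den)).map Sym.ofBit ++
  (if d.toRat.den = 1 then [] else
    Sym.point ::
      (fracBits (Nat.log 2 d.toRat.den) (d.toRat.num.natAbs % d.toRat.den)).map Sym.ofBit)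

/-- The binary string representing a dyadic number, as input or output of a machine. -/
def encode (d : Dyadic) : List Bool :=
  (numeral d).flatMap Sym.code

/-- The dyadic numbers in `[a, ∞)`. -/
abbrev Ray (a : Dyadic) : Type := {d : Dyadic // a ≤ d}

/-- `f : [a, ∞) → 𝔻` is polynomial time computable: some Turing machine maps the binary string of
each `d` in the domain to that of `f d`, in a number of steps that is bounded by a polynomial in
the length of the string of `d`. -/
def PolyTimeComputable {a : Dyadic} (f : Ray a → Dyadic) : Prop :=
  Nonempty (Turing.TM2ComputableInPolyTime (fun d : Ray a => encode d.1) encode f)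

/-- `m` is a modulus of continuity of `f : [a, ∞) → 𝔻`: for all `k`, `n` and all dyadic `x`, `y` in
`[a, a + 2 ^ k]`, if `|x - y| ≤ 2 ^ (-m(k, n))` then `|f x - f y| ≤ 2 ^ (-n)`. -/
def IsModulus {a : Dyadic} (f : Ray a → Dyadic) (m : ℕ → ℕ → ℕ) : Prop :=
  ∀ k n : ℕ, ∀ x y : Ray a,
    x.1.toRat ≤ a.toRat + 2 ^ k → y.1.toRat ≤ a.toRat + 2 ^ k →
    |x.1.toRat - y.1.toRat| ≤ (1 / 2 : ℚ) ^ m k n →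
    |(f x).toRat - (f y).toRat| ≤ (1 / 2 : ℚ) ^ n

/-- A dyadic function is continuous if it has a modulus of continuity. -/
def IsContinuous {a : Dyadic} (f : Ray a → Dyadic) : Prop :=
  ∃ m : ℕ → ℕ → ℕ, IsModulus f m

/-- `g` is bounded by a polynomial. -/
def PolyBounded (g : ℕ → ℕ) : Prop :=
  ∃ p : Polynomial ℕ, ∀ t : ℕ, g t ≤ p.eval t

end DyadicComplexity

open Turing

namespace DyadicComplexity

/-! On each interval [2^L, 2^(L+1)) the function is 2^L(1 + x) ↦ 2^L(1 + g(x)), where g(0) = 0, g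
maps [2^(-2^s), 2·2^(-2^s)) affinely onto [2^(-s-1), 2^(-s)), and g is constantly 2^(-s-1) on the
gap between this interval and the one for s + 1. So g behaves like 1/log(1/x) near 0, with
g(2^(-2^q)) = 2^(-q-1).

Lower bounds: from 2^j, an increment 2^(j-2^q) of the argument changes the value by 2^(j-q-1)
(`exists_steep_pair`). With j = 0 this forces exponential growth in n. With j = q + 2 the value
changes by 2, more than any 2^(-n), which forces exponential growth in k.

Continuity: the function is monotone (`contractRay_mono`) and onto the dyadics in [1, ∞)
(`contractRay_surj`), and a monotone map without jumps has a modulus on each bounded interval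
(`exists_modulus_at`).

Complexity: in binary, f shortens the run of zeros behind the leading 1 and keeps or drops the rest
according to whether the next 1 stands at a power-of-two position. One left-to-right scan with two
unary counters decides this (`contractDigits`, `stepsTo_run`), so a stack machine needs linear time.
-/

/-- With `M = 2 ^ L + w`, `w < 2 ^ L`, and `t` the position of the leading binary digit of `w` behind
that of `M`: the leading digit of `w` is moved to the position `log t + 1`, together with the digits
following it if `t` is a power of two, without them otherwise. -/
def contract (M : ℕ) : ℕ :=
  if M - 2 ^ Nat.log 2 M = 0 then M else
    2 ^ Nat.log 2 M +
      if Nat.log 2 M - Nat.log 2 (M - 2 ^ Nat.log 2 M) =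
          2 ^ Nat.log 2 (Nat.log 2 M - Nat.log 2 (M - 2 ^ Nat.log 2 M)) then
        (M - 2 ^ Nat.log 2 M) * 2 ^ (Nat.log 2 M - Nat.log 2 (M - 2 ^ Nat.log 2 M) -
          Nat.log 2 (Nat.log 2 M - Nat.log 2 (M - 2 ^ Nat.log 2 M)) - 1)
      else 2 ^ (Nat.log 2 M - Nat.log 2 (Nat.log 2 M - Nat.log 2 (M - 2 ^ Nat.log 2 M)) - 1)

/-! ### Arithmetic of `contract`: homogeneity, monotonicity, surjectivity up to scaling -/

theorem log_two_eq {r w : ℕ} (h1 : 2 ^ r ≤ w) (h2 : w < 2 ^ (r + 1)) : Nat.log 2 w = r :=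
  (Nat.log_eq_iff (Or.inr ⟨by norm_num, by have := Nat.two_pow_pos r; omega⟩)).2 ⟨h1, h2⟩

theorem contract_two_pow (L : ℕ) : contract (2 ^ L) = 2 ^ L := by
  simp [contract, Nat.log_pow]

theorem contract_add {r t s w : ℕ} (hw1 : 2 ^ r ≤ w) (hw2 : w < 2 ^ (r + 1)) (ht : 1 ≤ t)
    (hs1 : 2 ^ s ≤ t) (hs2 : t < 2 ^ (s + 1)) :
    contract (2 ^ (r + t) + w) =
      2 ^ (r + t) + if t = 2 ^ s then w * 2 ^ (t - s - 1) else 2 ^ (r + t - s - 1) := by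
  have h0 : 2 ^ (r + 1) ≤ 2 ^ (r + t) := Nat.pow_le_pow_right (by norm_num) (by omega)
  have hL : Nat.log 2 (2 ^ (r + t) + w) = r + t :=
    log_two_eq (by omega) (by rw [pow_succ]; omega)
  have hr : Nat.log 2 w = r := log_two_eq hw1 hw2
  have hs : Nat.log 2 t = s := log_two_eq hs1 hs2
  have hpos := Nat.two_pow_pos r
  have e1 : 2 ^ (r + t) + w - 2 ^ (r + t) = w := by omega
  have e2 : r + t - r = t := by omega
  rw [contract, hL, e1, hr, e2, hs, if_neg (by omega)]

theorem eq_two_pow_or {M : ℕ} (hM : 1 ≤ M) : (∃ L, M = 2 ^ L) ∨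
    ∃ r t s w, M = 2 ^ (r + t) + w ∧ 2 ^ r ≤ w ∧ w < 2 ^ (r + 1) ∧ 1 ≤ t ∧ 2 ^ s ≤ t ∧
      t < 2 ^ (s + 1) := by
  have h1 : 2 ^ Nat.log 2 M ≤ M := Nat.pow_log_le_self 2 (by omega)
  have h2 : M < 2 ^ (Nat.log 2 M + 1) := Nat.lt_pow_succ_log_self (by norm_num) M
  obtain ⟨w, hw⟩ := Nat.exists_eq_add_of_le h1
  rcases Nat.eq_zero_or_pos w with h0 | h0
  · exact Or.inl ⟨Nat.log 2 M, by omega⟩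
  · have h3 : 2 ^ Nat.log 2 w ≤ w := Nat.pow_log_le_self 2 (by omega)
    have h4 : w < 2 ^ (Nat.log 2 w + 1) := Nat.lt_pow_succ_log_self (by norm_num) w
    have h5 : Nat.log 2 w < Nat.log 2 M := by
      apply (Nat.pow_lt_pow_iff_right (a := 2) (by norm_num)).1
      rw [pow_succ] at h2; omega
    have e : Nat.log 2 w + (Nat.log 2 M - Nat.log 2 w) = Nat.log 2 M := by omega
    refine Or.inr ⟨Nat.log 2 w, Nat.log 2 M - Nat.log 2 w, Nat.log 2 (Nat.log 2 M - Nat.log 2 w), w,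
      ?_, h3, h4, by omega, Nat.pow_log_le_self 2 (by omega),
      Nat.lt_pow_succ_log_self (by norm_num) _⟩
    rw [e]; exact hw

theorem succ_le_of_two_pow_le {s t : ℕ} (h : 2 ^ s ≤ t) : s + 1 ≤ t :=
  (Nat.lt_two_pow_self (n := s)).trans_le h

/-- Appending a zero digit leaves `t`, hence `s`, unchanged. This homogeneity makes `contract M / 2
^ e` depend only on the value `M / 2 ^ e`. -/
theorem contract_two_mul {M : ℕ} (hM : 1 ≤ M) : contract (2 * M) = 2 * contract M := by
  rcases eq_two_pow_or hM with ⟨L, rfl⟩ | ⟨r, t, s, w, rfl, h1, h2, h3, h4, h5⟩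
  · rw [← pow_succ', contract_two_pow, contract_two_pow, pow_succ']
  · have e : 2 * (2 ^ (r + t) + w) = 2 ^ (r + 1 + t) + 2 * w := by ring
    have := succ_le_of_two_pow_le h4
    rw [e, contract_add (s := s) (by rw [pow_succ]; omega) (by rw [pow_succ]; omega) h3 h4 h5,
      contract_add h1 h2 h3 h4 h5]
    have e2 : r + 1 + t - s - 1 = (r + t - s - 1) + 1 := by omega
    rw [e2]
    split_ifs <;> ring

theorem contract_mul_two_pow {M : ℕ} (hM : 1 ≤ M) (c : ℕ) :
    contract (2 ^ c * M) = 2 ^ c * contract M := by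
  induction c with
  | zero => simp
  | succ c ih =>
    rw [pow_succ', mul_assoc, contract_two_mul (Nat.mul_pos (Nat.two_pow_pos c) hM), ih, mul_assoc]

/-- In both branches the second digit 1 of the result stands exactly `s + 1` places behind the
first. -/
theorem contract_add_bounds {r t s w : ℕ} (hw1 : 2 ^ r ≤ w) (hw2 : w < 2 ^ (r + 1)) (ht : 1 ≤ t)
    (hs1 : 2 ^ s ≤ t) (hs2 : t < 2 ^ (s + 1)) :
    2 ^ (r + t) + 2 ^ (r + t - s - 1) ≤ contract (2 ^ (r + t) + w) ∧
      contract (2 ^ (r + t) + w) < 2 ^ (r + t) + 2 ^ (r + t - s) := by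
  have := succ_le_of_two_pow_le hs1
  have e : r + t - s = (r + t - s - 1) + 1 := by omega
  have hp := Nat.two_pow_pos (r + t - s - 1)
  rw [contract_add hw1 hw2 ht hs1 hs2, e, pow_succ]
  split_ifs
  · have e1 : r + t - s - 1 = r + (t - s - 1) := by omega
    have hq := Nat.two_pow_pos (t - s - 1)
    simp only [Nat.add_sub_cancel, e1, pow_add _ r]
    constructor
    · gcongr
    · rw [pow_succ] at hw2
      have := Nat.mul_lt_mul_of_pos_right hw2 hq
      linarith
  · simp only [Nat.add_sub_cancel]
    omega

theorem contract_bounds {M L : ℕ} (h1 : 2 ^ L ≤ M) (h2 : M < 2 ^ (L + 1)) :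
    2 ^ L ≤ contract M ∧ contract M < 2 ^ (L + 1) := by
  have hL := log_two_eq h1 h2
  rcases eq_two_pow_or (M := M) ((Nat.two_pow_pos L).trans_le h1) with
    ⟨L', rfl⟩ | ⟨r, t, s, w, rfl, g1, g2, g3, g4, g5⟩
  · rw [contract_two_pow]; exact ⟨h1, h2⟩
  · have hl : Nat.log 2 (2 ^ (r + t) + w) = r + t := by
      have : 2 ^ (r + 1) ≤ 2 ^ (r + t) := Nat.pow_le_pow_right (by norm_num) (by omega)
      exact log_two_eq (by omega) (by rw [pow_succ]; omega)
    obtain rfl : r + t = L := hl.symm.trans hL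
    have := contract_add_bounds g1 g2 g3 g4 g5
    have h3 : 2 ^ (r + t - s) ≤ 2 ^ (r + t) := Nat.pow_le_pow_right (by norm_num) (by omega)
    have h4 := Nat.two_pow_pos (r + t - s - 1)
    rw [pow_succ]
    omega

/-- For equal leading digits, compare the places of the second digit 1. Different values of `s` are
separated by `contract_add_bounds`; within one `s`, the affine piece `t = 2 ^ s` lies above the
plateau. -/
theorem contract_mono {M N : ℕ} (hM : 1 ≤ M) (h : M ≤ N) : contract M ≤ contract N := by
  have hM1 := contract_bounds (Nat.pow_log_le_self 2 (by omega : M ≠ 0))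
    (Nat.lt_pow_succ_log_self (by norm_num) M)
  have hN1 := contract_bounds (Nat.pow_log_le_self 2 (by omega : N ≠ 0))
    (Nat.lt_pow_succ_log_self (by norm_num) N)
  rcases (Nat.log_mono_right (b := 2) h).lt_or_eq with hl | hl
  · have : 2 ^ (Nat.log 2 M + 1) ≤ 2 ^ Nat.log 2 N := Nat.pow_le_pow_right (by norm_num) hl
    omega
  rcases eq_two_pow_or hM with ⟨L, rfl⟩ | ⟨r, t, s, w, rfl, g1, g2, g3, g4, g5⟩
  · rw [contract_two_pow]
    rw [Nat.log_pow (by norm_num)] at hl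
    rw [← hl] at hN1
    exact hN1.1
  have hlog : ∀ {r t w : ℕ}, w < 2 ^ (r + 1) → 1 ≤ t →
      Nat.log 2 (2 ^ (r + t) + w) = r + t := by
    intro r t w h1 h2
    have : 2 ^ (r + 1) ≤ 2 ^ (r + t) := Nat.pow_le_pow_right (by norm_num) (by omega)
    exact log_two_eq (by omega) (by rw [pow_succ]; omega)
  rcases eq_two_pow_or (hM.trans h) with ⟨L, rfl⟩ | ⟨r', t', s', w', rfl, k1, k2, k3, k4, k5⟩
  · rw [Nat.log_pow (by norm_num), hlog g2 g3] at hl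
    rw [hl] at h
    have := Nat.two_pow_pos r
    omega
  rw [hlog g2 g3, hlog k2 k3] at hl
  have hww : w ≤ w' := by rw [hl] at h; omega
  have hrr : r ≤ r' := by
    by_contra hc
    have : 2 ^ (r' + 1) ≤ 2 ^ r := Nat.pow_le_pow_right (by norm_num) (by omega)
    omega
  rcases hrr.lt_or_eq with hr | rfl
  · have b1 := contract_add_bounds g1 g2 g3 g4 g5
    have b2 := contract_add_bounds k1 k2 k3 k4 k5
    have hss : s' ≤ s := by
      by_contra hc
      have : 2 ^ (s + 1) ≤ 2 ^ s' := Nat.pow_le_pow_right (by norm_num) (by omega)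
      omega
    rcases hss.lt_or_eq with hs | rfl
    · have : 2 ^ (r + t - s) ≤ 2 ^ (r' + t' - s' - 1) :=
        Nat.pow_le_pow_right (by norm_num) (by omega)
      have e : 2 ^ (r + t) = 2 ^ (r' + t') := by rw [hl]
      omega
    -- Here `2 ^ s ≤ t' < t`, so `t` is no power of two: the smaller argument is on the plateau,
    -- whose value is the lower bound for this `s`.
    · refine le_trans (le_of_eq ?_) b2.1
      rw [contract_add g1 g2 g3 g4 g5, if_neg (by omega), hl]
  · obtain rfl : t = t' := by omega
    obtain rfl : s = s' := (log_two_eq g4 g5).symm.trans (log_two_eq k4 k5)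
    rw [contract_add g1 g2 g3 g4 g5, contract_add k1 k2 k3 k4 k5]
    split_ifs
    · gcongr
    · exact le_rfl

theorem contract_surj {N : ℕ} (hN : 1 ≤ N) :
    ∃ c M, 1 ≤ M ∧ contract M = 2 ^ c * N := by
  rcases eq_two_pow_or hN with ⟨L, rfl⟩ | ⟨r, t, s, w, rfl, h1, h2, h3, h4, h5⟩
  · exact ⟨0, 2 ^ L, Nat.one_le_two_pow, by simp [contract_two_pow]⟩
  · obtain ⟨q, rfl⟩ := Nat.exists_eq_add_of_le' h3
    -- The second digit of `N` is `q + 1` places behind the first; moving it to place `2 ^ q`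
    -- inverts the affine piece. The factor `2 ^ 2 ^ q` makes room for the added zeros.
    refine ⟨2 ^ q, 2 ^ ((r + (q + 1)) + 2 ^ q) + w * 2 ^ (q + 1), ?_, ?_⟩
    · exact Nat.one_le_two_pow.trans (Nat.le_add_right _ _)
    · have hq : q + 1 ≤ 2 ^ q := Nat.lt_two_pow_self
      rw [contract_add (r := r + (q + 1)) (t := 2 ^ q) (s := q)
        (by rw [pow_add]; gcongr) _ (Nat.one_le_two_pow) le_rfl
        (by rw [pow_succ]; have := Nat.two_pow_pos q; omega), if_pos rfl, mul_assoc, ← pow_add]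
      · have : q + 1 + (2 ^ q - q - 1) = 2 ^ q := by omega
        rw [this]
        ring
      · have : 2 ^ (r + (q + 1) + 1) = 2 ^ (r + 1) * 2 ^ (q + 1) := by ring
        rw [this]
        gcongr

/-! ### Digit lists and binary numerals of dyadics -/

/-- The number with given binary digits, most significant digit first. -/
def bitVal : List Bool → ℕ
  | [] => 0
  | b :: l => b.toNat * 2 ^ l.length + bitVal l

theorem bitVal_append (l l' : List Bool) :
    bitVal (l ++ l') = bitVal l * 2 ^ l'.length + bitVal l' := by
  induction l with
  | nil => simp [bitVal]
  | cons b l ih => simp [bitVal, ih, pow_add]; ring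

theorem bitVal_lt (l : List Bool) : bitVal l < 2 ^ l.length := by
  induction l with
  | nil => simp [bitVal]
  | cons b l ih => cases b <;> simp [bitVal, pow_succ] <;> omega

theorem bitVal_replicate_false (n : ℕ) : bitVal (List.replicate n false) = 0 := by
  induction n with
  | zero => rfl
  | succ n ih => simp [List.replicate_succ, bitVal, ih]

theorem two_pow_le_bitVal (l : List Bool) : 2 ^ l.length ≤ bitVal (true :: l) := by
  simp [bitVal]

theorem natBits_bitVal (l : List Bool) : natBits (bitVal (true :: l)) = true :: l := by
  have hne : ∀ l : List Bool, bitVal (true :: l) ≠ 0 := fun l => by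
    have := two_pow_le_bitVal l
    have := Nat.two_pow_pos l.length
    omega
  rw [natBits, if_neg (hne l)]
  induction l using List.reverseRecOn with
  | nil => decide
  | append_singleton l b ih =>
    have e : bitVal (true :: (l ++ [b])) = Nat.bit b (bitVal (true :: l)) := by
      rw [← List.cons_append, bitVal_append]
      cases b <;> simp [bitVal, Nat.bit] <;> ring
    rw [e, Nat.bits_append_bit _ _ (fun h => absurd h (hne l)), List.reverse_cons, ih]
    simp

theorem fracBits_bitVal (l : List Bool) : fracBits l.length (bitVal l) = l := by
  induction l with
  | nil => rfl
  | cons b l ih =>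
    have hl := bitVal_lt l
    have e : bitVal (b :: l) = 2 ^ l.length * b.toNat + bitVal l := by rw [bitVal, mul_comm]
    rw [fracBits, List.length_cons, List.range_succ, List.reverse_append, e]
    simp only [List.reverse_cons, List.reverse_nil, List.nil_append, List.map_cons, List.cons_append]
    congr 1
    · rw [Nat.testBit_two_pow_mul_add _ hl]
      cases b <;> simp
    · conv_rhs => rw [← ih]
      rw [fracBits]
      apply List.map_congr_left
      intro i hi
      simp at hi
      rw [Nat.testBit_two_pow_mul_add _ hl, if_pos hi]

theorem exists_bitVal_eq {N : ℕ} (hN : 1 ≤ N) : ∃ l, bitVal (true :: l) = N := by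
  induction N using Nat.strong_induction_on with
  | _ N ih =>
    rcases Nat.lt_or_ge N 2 with h | h
    · exact ⟨[], by simp [bitVal]; omega⟩
    · obtain ⟨l, hl⟩ := ih (N / 2) (by omega) (by omega)
      refine ⟨l ++ [decide (N % 2 = 1)], ?_⟩
      rw [← List.cons_append, bitVal_append, hl]
      rcases Nat.mod_two_eq_zero_or_one N with h | h <;> simp [h, bitVal] <;> omega

theorem exists_bitVal_eq_of_lt {e N : ℕ} (hN : N < 2 ^ e) :
    ∃ l : List Bool, l.length = e ∧ bitVal l = N := by
  induction e generalizing N with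
  | zero => exact ⟨[], rfl, by simp at hN; simp [bitVal, hN]⟩
  | succ e ih =>
    rw [pow_succ] at hN
    rcases Nat.lt_or_ge N (2 ^ e) with h | h
    · obtain ⟨l, h1, h2⟩ := ih h
      exact ⟨false :: l, by simp [h1], by simp [bitVal, h2]⟩
    · obtain ⟨l, h1, h2⟩ := ih (N := N - 2 ^ e) (by omega)
      exact ⟨true :: l, by simp [h1], by simp [bitVal, h2, h1]; omega⟩

/-- `l` and `l'` are the digits before and behind the point of the binary numeral of `d ≥ 1`. -/
structure HasDigits (d : Dyadic) (l l' : List Bool) : Prop where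
  toRat_eq : d.toRat = (bitVal (true :: l ++ l') : ℚ) / 2 ^ l'.length
  last : ∀ b ∈ l'.getLast?, b = true

theorem bitVal_mod_two {l : List Bool} (hl : l ≠ []) (h : ∀ b ∈ l.getLast?, b = true) :
    bitVal l % 2 = 1 := by
  rcases l.eq_nil_or_concat' with rfl | ⟨l, b, rfl⟩
  · simp at hl
  · obtain rfl : b = true := h b (by simp)
    simp [bitVal_append, bitVal]

/-- The fraction is already reduced: either the denominator is 1, or the last digit 1 makes the
numerator odd. -/
theorem HasDigits.numeral_eq {d : Dyadic} {l l' : List Bool} (h : HasDigits d l l') :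
    numeral d = (true :: l).map Sym.ofBit ++
      (if l' = [] then [] else Sym.point :: l'.map Sym.ofBit) := by
  have hco : Nat.Coprime (bitVal (true :: l ++ l')) (2 ^ l'.length) := by
    rcases eq_or_ne l' [] with rfl | hne
    · simp
    · apply Nat.Coprime.pow_right
      rw [Nat.coprime_two_right, Nat.odd_iff, bitVal_append, Nat.add_mod, Nat.mul_mod]
      rw [bitVal_mod_two hne h.last, Nat.pow_mod]
      simp [hne]
  have e : d.toRat = ((bitVal (true :: l ++ l') : ℤ) : ℚ) / ((2 ^ l'.length : ℕ) : ℤ) := by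
    rw [h.toRat_eq]; push_cast; rfl
  have hnum : d.toRat.num = (bitVal (true :: l ++ l') : ℤ) := by
    rw [e]
    exact Rat.num_div_eq_of_coprime (by positivity) (by simpa using hco)
  have hden : d.toRat.den = 2 ^ l'.length := by
    have : (d.toRat.den : ℤ) = ((2 ^ l'.length : ℕ) : ℤ) := by
      rw [e]
      exact Rat.den_div_eq_of_coprime (by positivity) (by simpa using hco)
    exact_mod_cast this
  have hneg : ¬ d.toRat < 0 := by
    rw [h.toRat_eq, not_lt]; positivity
  have hlt := bitVal_lt l'
  rw [numeral, if_neg hneg, hnum, hden, Int.natAbs_natCast, bitVal_append,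
    Nat.log_pow (by norm_num), mul_comm (bitVal (true :: l)),
    Nat.mul_add_div (Nat.two_pow_pos _), Nat.div_eq_of_lt hlt, Nat.mul_add_mod,
    Nat.mod_eq_of_lt hlt, Nat.add_zero, natBits_bitVal, fracBits_bitVal]
  simp

theorem exists_hasDigits {d : Dyadic} (hd : 1 ≤ d) : ∃ l l', HasDigits d l l' := by
  have h1 : (1 : ℚ) ≤ d.toRat := by
    have := Dyadic.toRat_le_toRat_iff.2 hd
    rwa [show (1 : Dyadic) = ((1 : ℕ) : Dyadic) from rfl, Dyadic.toRat_natCast, Nat.cast_one] at this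
  obtain ⟨M, e, hM, hMe⟩ : ∃ M e : ℕ, d.toRat = (M : ℚ) / 2 ^ e ∧ (e = 0 ∨ M % 2 = 1) := by
    rcases d with _ | ⟨n, k, hn⟩
    · simp at h1; norm_num at h1
    · rw [Dyadic.toRat_ofOdd_eq_mul_two_pow] at h1 ⊢
      have hn0 : 0 < n := by
        by_contra hc
        have h2 : (n : ℚ) ≤ 0 := by exact_mod_cast not_lt.1 hc
        have : (n : ℚ) * 2 ^ (-k) ≤ 0 := mul_nonpos_of_nonpos_of_nonneg h2 (by positivity)
        linarith
      lift n to ℕ using hn0.le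
      rcases le_total 0 k with hk | hk
      · lift k to ℕ using hk
        refine ⟨n, k, ?_, Or.inr (by omega)⟩
        rw [zpow_neg, zpow_natCast]; simp [div_eq_mul_inv]
      · obtain ⟨j, rfl⟩ : ∃ j : ℕ, k = -(j : ℤ) := ⟨(-k).toNat, by omega⟩
        exact ⟨n * 2 ^ j, 0, by simp, Or.inl rfl⟩
  have hle : 2 ^ e ≤ M := by
    rw [hM, le_div_iff₀ (by positivity), one_mul] at h1
    exact_mod_cast h1
  obtain ⟨l, hl⟩ := exists_bitVal_eq (N := M / 2 ^ e) (Nat.div_pos hle (Nat.two_pow_pos e))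
  obtain ⟨l', hl', hv⟩ := exists_bitVal_eq_of_lt (Nat.mod_lt M (Nat.two_pow_pos e))
  have hval : bitVal (true :: l ++ l') = M := by
    rw [bitVal_append, hl, hv, hl', mul_comm]
    exact Nat.div_add_mod M _
  refine ⟨l, l', by rw [hval, hl', hM], fun b hb => ?_⟩
  rcases l'.eq_nil_or_concat' with rfl | ⟨l2, b2, rfl⟩
  · simp at hb
  · simp at hb
    subst hb
    rcases hMe with h0 | h0
    · subst h0; simp at hl'
    · rw [← hval, bitVal_append, bitVal_append] at h0
      cases b2
      · simp [bitVal, pow_succ, ← mul_assoc] at h0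
      · rfl

/-! ### The function on the ray -/

/-- The function `m / 2 ^ e ↦ contract m / 2 ^ e` on `[1, ∞)`. -/
def contractRay (d : Ray 1) : Dyadic :=
  Dyadic.ofIntWithPrec (contract d.1.toRat.num.natAbs) (Nat.log 2 d.1.toRat.den)

/-- Any representation arises from the reduced one by a power of two, which `contract` respects;
fractions therefore need not be reduced below. -/
theorem toRat_contractRay {d : Ray 1} {M e : ℕ} (hM : 1 ≤ M) (h : d.1.toRat = (M : ℚ) / 2 ^ e) :
    (contractRay d).toRat = (contract M : ℚ) / 2 ^ e := by
  have hdvd : d.1.toRat.den ∣ 2 ^ e := by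
    have := Rat.den_dvd (M : ℤ) ((2 ^ e : ℕ) : ℤ)
    rw [← Int.natCast_dvd_natCast, h]
    convert! this using 3
    rw [Rat.divInt_eq_div]
    push_cast
    rfl
  obtain ⟨e', he', hden⟩ := (Nat.dvd_prime_pow Nat.prime_two).1 hdvd
  obtain ⟨c, rfl⟩ := Nat.exists_eq_add_of_le he'
  have hpos : 0 ≤ d.1.toRat.num := Rat.num_nonneg.2 (by rw [h]; positivity)
  have hnum : M = 2 ^ c * d.1.toRat.num.natAbs := by
    have h1 := (Rat.num_div_den d.1.toRat).trans h
    rw [hden] at h1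
    have h2 : (d.1.toRat.num : ℚ) = (d.1.toRat.num.natAbs : ℚ) := by
      rw [← Int.cast_natCast, Int.natAbs_of_nonneg hpos]
    rw [h2, div_eq_div_iff (by positivity) (by positivity), pow_add] at h1
    push_cast at h1
    have h3 : (2 : ℚ) ^ e' ≠ 0 := by positivity
    have h4 : (M : ℚ) = 2 ^ c * d.1.toRat.num.natAbs := by
      apply mul_right_cancel₀ h3
      rw [← h1]; ring
    exact_mod_cast h4
  have hn : 1 ≤ d.1.toRat.num.natAbs := by
    rcases Nat.eq_zero_or_pos d.1.toRat.num.natAbs with h0 | h0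
    · rw [h0] at hnum; omega
    · exact h0
  rw [contractRay, Dyadic.toRat_ofIntWithPrec_eq_mul_two_pow, hden, Nat.log_pow (by norm_num), hnum,
    contract_mul_two_pow hn, zpow_neg, zpow_natCast, pow_add]
  push_cast
  field_simp

theorem Dyadic.toRat_one : (1 : Dyadic).toRat = 1 := by
  rw [show (1 : Dyadic) = ((1 : ℕ) : Dyadic) from rfl, Dyadic.toRat_natCast, Nat.cast_one]

theorem Ray.exists_eq_div (d : Ray 1) : ∃ M e : ℕ, 1 ≤ M ∧ d.1.toRat = (M : ℚ) / 2 ^ e := by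
  obtain ⟨l, l', h⟩ := exists_hasDigits d.2
  exact ⟨_, _, Nat.one_le_two_pow.trans (two_pow_le_bitVal _), h.toRat_eq⟩

theorem exists_ray {M e : ℕ} (h : 2 ^ e ≤ M) : ∃ d : Ray 1, d.1.toRat = (M : ℚ) / 2 ^ e := by
  have h1 : (Dyadic.ofIntWithPrec M e).toRat = (M : ℚ) / 2 ^ e := by
    rw [Dyadic.toRat_ofIntWithPrec_eq_mul_two_pow, zpow_neg, zpow_natCast, div_eq_mul_inv]
    push_cast
    rfl
  refine ⟨⟨Dyadic.ofIntWithPrec M e, ?_⟩, h1⟩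
  rw [← Dyadic.toRat_le_toRat_iff, h1, Dyadic.toRat_one, le_div_iff₀ (by positivity), one_mul]
  exact_mod_cast h

/-! ### Monotonicity, surjectivity and continuity -/

theorem contractRay_mono {x y : Ray 1} (h : x.1.toRat ≤ y.1.toRat) :
    (contractRay x).toRat ≤ (contractRay y).toRat := by
  obtain ⟨M, e, hM, hx⟩ := x.exists_eq_div
  obtain ⟨N, e', hN, hy⟩ := y.exists_eq_div
  rw [toRat_contractRay hM hx, toRat_contractRay hN hy, div_le_div_iff₀ (by positivity)
    (by positivity)]
  rw [hx, hy, div_le_div_iff₀ (by positivity) (by positivity)] at h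
  have h1 : 2 ^ e' * M ≤ 2 ^ e * N := by
    rw [mul_comm _ M, mul_comm _ N]
    exact_mod_cast h
  have h2 := contract_mono (Nat.mul_pos (Nat.two_pow_pos e') hM) h1
  rw [contract_mul_two_pow hM, contract_mul_two_pow hN, mul_comm _ (contract M),
    mul_comm _ (contract N)] at h2
  exact_mod_cast h2

theorem one_le_toRat_contractRay (x : Ray 1) : 1 ≤ (contractRay x).toRat := by
  obtain ⟨d, hd⟩ := exists_ray (M := 1) (e := 0) le_rfl
  have h1 := toRat_contractRay le_rfl hd
  have h2 : contract 1 = 1 := contract_two_pow 0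
  have h3 : d.1.toRat ≤ x.1.toRat := by
    rw [hd, Nat.cast_one, pow_zero, div_one, ← Dyadic.toRat_one]
    exact Dyadic.toRat_le_toRat_iff.2 x.2
  have := contractRay_mono h3
  rw [h1, h2] at this
  simpa using this

theorem contractRay_surj {N e : ℕ} (h : 2 ^ e ≤ N) :
    ∃ x, (contractRay x).toRat = (N : ℚ) / 2 ^ e := by
  obtain ⟨c, M, hM, hc⟩ := contract_surj (Nat.one_le_two_pow.trans h)
  -- `contract` preserves the number of binary digits, so the preimage is again at least 1.
  have hlt : 2 ^ (c + e) ≤ M := by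
    by_contra hlt
    have h2 := contract_bounds (Nat.pow_log_le_self 2 (by omega : M ≠ 0))
      (Nat.lt_pow_succ_log_self (by norm_num) M)
    have h3 : Nat.log 2 M < c + e := Nat.log_lt_of_lt_pow (by omega) (by omega)
    have h4 : 2 ^ (Nat.log 2 M + 1) ≤ 2 ^ (c + e) := Nat.pow_le_pow_right (by norm_num) h3
    have h5 : 2 ^ (c + e) ≤ 2 ^ c * N := by rw [pow_add]; gcongr
    omega
  obtain ⟨x, hx⟩ := exists_ray hlt
  refine ⟨x, ?_⟩
  rw [toRat_contractRay hM hx, hc, pow_add]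
  push_cast
  field_simp

/-- Choose preimages `p i` of the grid points 1 + i/2^(n+1). By monotonicity they strictly increase,
and only finitely many matter below 1 + 2^k. Arguments closer than every relevant gap have values
within two grid cells, that is, within 2^(-n). -/
theorem exists_modulus_at (k n : ℕ) : ∃ m : ℕ, ∀ x y : Ray 1, x.1.toRat ≤ y.1.toRat →
    y.1.toRat ≤ 1 + 2 ^ k → y.1.toRat - x.1.toRat ≤ (1 / 2 : ℚ) ^ m →
    (contractRay y).toRat - (contractRay x).toRat ≤ (1 / 2 : ℚ) ^ n := by
  have hgrid : ∀ i : ℕ, ∃ x : Ray 1, (contractRay x).toRat = 1 + (i : ℚ) / 2 ^ (n + 1) := fun i => by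
    obtain ⟨x, hx⟩ := contractRay_surj (Nat.le_add_right (2 ^ (n + 1)) i)
    refine ⟨x, ?_⟩
    rw [hx]
    push_cast
    field_simp
  choose p hp using hgrid
  have hgap : ∀ i, ∃ m : ℕ, (1 / 2 : ℚ) ^ m < (p (i + 1)).1.toRat - (p i).1.toRat := fun i => by
    apply exists_pow_lt_of_lt_one _ (by norm_num)
    rw [sub_pos]
    by_contra hc
    have := contractRay_mono (not_lt.1 hc)
    rw [hp, hp] at this
    have h2 : (0 : ℚ) < 1 / 2 ^ (n + 1) := by positivity
    push_cast at this
    rw [add_div] at this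
    linarith
  choose g hg using hgap
  obtain ⟨b, hb⟩ := exists_ray (M := 1 + 2 ^ k) (e := 0) (by simp)
  obtain ⟨K, hK⟩ := exists_nat_gt (((contractRay b).toRat - 1) * 2 ^ (n + 1))
  -- If the value at `x` is in cell `i`, then `x ≤ p (i + 1)`, so only the next gap, from `p (i +
  -- 1)` to `p (i + 2)`, has to exceed the distance; hence the shift in `g (i + 1)`.
  refine ⟨(Finset.range (K + 1)).sup fun i => g (i + 1), fun x y hxy hy hd => ?_⟩
  have hx1 := one_le_toRat_contractRay x
  have hpow : (0 : ℚ) < 2 ^ (n + 1) := by positivity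
  set v := ((contractRay x).toRat - 1) * 2 ^ (n + 1) with hv
  have hv0 : 0 ≤ v := mul_nonneg (by linarith) hpow.le
  have hxv : (contractRay x).toRat = 1 + v / 2 ^ (n + 1) := by rw [hv]; field_simp; ring
  have hi1 := Nat.floor_le hv0
  have hi2 := Nat.lt_floor_add_one v
  set i := ⌊v⌋₊ with hi
  have hiK : i < K + 1 := by
    have hxb : x.1.toRat ≤ b.1.toRat := by
      rw [hb]; push_cast; rw [pow_zero, div_one]; linarith
    have h1 : v ≤ ((contractRay b).toRat - 1) * 2 ^ (n + 1) := by
      have := contractRay_mono hxb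
      rw [hv]; gcongr
    have : (i : ℚ) < K := by linarith
    have : i < K := by exact_mod_cast this
    omega
  have hlt1 : x.1.toRat ≤ (p (i + 1)).1.toRat := by
    by_contra hc
    have := contractRay_mono (not_le.1 hc).le
    rw [hp, hxv] at this
    have h3 := div_lt_div_of_pos_right hi2 hpow
    push_cast at this
    linarith
  have hlt2 : y.1.toRat ≤ (p (i + 2)).1.toRat := by
    have h1 := hg (i + 1)
    have h2 : g (i + 1) ≤ (Finset.range (K + 1)).sup fun i => g (i + 1) :=
      Finset.le_sup (f := fun i => g (i + 1)) (Finset.mem_range.2 hiK)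
    have h3 : (1 / 2 : ℚ) ^ ((Finset.range (K + 1)).sup fun i => g (i + 1)) ≤
        (1 / 2) ^ g (i + 1) := pow_le_pow_of_le_one (by norm_num) (by norm_num) h2
    have e : i + 1 + 1 = i + 2 := rfl
    rw [e] at h1
    linarith
  have h4 := contractRay_mono hlt2
  rw [hp] at h4
  rw [hxv]
  have h5 : (i : ℚ) / 2 ^ (n + 1) ≤ v / 2 ^ (n + 1) := by gcongr
  have h6 : ((i + 2 : ℕ) : ℚ) / 2 ^ (n + 1) = (i : ℚ) / 2 ^ (n + 1) + (1 / 2) ^ n := by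
    rw [one_div, inv_pow]
    push_cast
    field_simp
    ring
  linarith

theorem isContinuous_contractRay : IsContinuous contractRay := by
  choose m hm using exists_modulus_at
  refine ⟨m, fun k n x y hx hy h => ?_⟩
  rw [Dyadic.toRat_one] at hx hy
  rcases le_total x.1.toRat y.1.toRat with hxy | hxy
  · rw [abs_sub_comm, abs_of_nonneg (sub_nonneg.2 hxy)] at h
    rw [abs_sub_comm, abs_of_nonneg (sub_nonneg.2 (contractRay_mono hxy))]
    exact hm k n x y hxy hy h
  · rw [abs_of_nonneg (sub_nonneg.2 hxy)] at h
    rw [abs_of_nonneg (sub_nonneg.2 (contractRay_mono hxy))]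
    exact hm k n y x hxy hx h

/-! ### Steepness to the right of powers of two, and the lower bounds -/

theorem exists_steep_pair (j q : ℕ) : ∃ x y : Ray 1, x.1.toRat = 2 ^ j ∧
    y.1.toRat = 2 ^ j + 2 ^ j / 2 ^ 2 ^ q ∧
    (contractRay y).toRat - (contractRay x).toRat = 2 ^ j / 2 ^ (q + 1) := by
  obtain ⟨x, hx⟩ := exists_ray (M := 2 ^ j) (e := 0) (by simpa using Nat.one_le_two_pow)
  obtain ⟨y, hy⟩ := exists_ray (M := 2 ^ (j + 2 ^ q) + 2 ^ j) (e := 2 ^ q)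
    (le_trans (Nat.pow_le_pow_right (by norm_num) (by omega)) (Nat.le_add_right _ _))
  refine ⟨x, y, by simpa using hx, ?_, ?_⟩
  · rw [hy]
    push_cast
    rw [pow_add]
    field_simp
  · have hq : q + 1 ≤ 2 ^ q := Nat.lt_two_pow_self
    obtain ⟨c, hc⟩ := Nat.exists_eq_add_of_le hq
    rw [toRat_contractRay Nat.one_le_two_pow hx,
      toRat_contractRay (Nat.one_le_two_pow.trans (Nat.le_add_right _ _)) hy, contract_two_pow,
      contract_add (r := j) (s := q) le_rfl (Nat.pow_lt_pow_right (by norm_num) (by omega))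
        Nat.one_le_two_pow le_rfl (Nat.pow_lt_pow_right (by norm_num) (by omega)), if_pos rfl]
    have e : 2 ^ q - q - 1 = c := by omega
    rw [e, hc]
    push_cast
    rw [pow_add _ j, pow_add _ (q + 1) c]
    field_simp
    ring

/-- Otherwise the steep pair, at distance 2^(j-2^q), would be within 2^(-m(k,n)), although its
values differ by more than 2^(-n). -/
theorem IsModulus.lt_of_steep {m : ℕ → ℕ → ℕ} (hm : IsModulus contractRay m) {j k n q : ℕ}
    (h1 : (2 : ℚ) ^ j + 2 ^ j / 2 ^ 2 ^ q ≤ 1 + 2 ^ k) (h2 : (1 / 2 : ℚ) ^ n < 2 ^ j / 2 ^ (q + 1)) :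
    2 ^ q < m k n + j := by
  obtain ⟨x, y, hx, hy, hd⟩ := exists_steep_pair j q
  by_contra hc
  have hpos : (0 : ℚ) < 2 ^ j / 2 ^ 2 ^ q := by positivity
  have h3 := hm k n x y
    (by rw [hx, Dyadic.toRat_one]; linarith) (by rw [hy, Dyadic.toRat_one]; exact h1) (by
      rw [hx, hy, abs_sub_comm, add_sub_cancel_left, abs_of_pos hpos, one_div, inv_pow,
        div_le_iff₀ (by positivity), ← div_eq_inv_mul, le_div_iff₀ (by positivity), ← pow_add]
      exact pow_le_pow_right₀ (by norm_num) (by omega))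
  rw [abs_sub_comm] at h3
  have := (le_abs_self _).trans h3
  rw [hd] at this
  linarith

theorem eventually_eval_lt_two_pow (p : Polynomial ℕ) :
    ∀ᶠ q : ℕ in Filter.atTop, p.eval q < 2 ^ q := by
  have h : Filter.Tendsto (fun q : ℕ => ((p.eval q : ℕ) : ℝ) / 2 ^ q) Filter.atTop (nhds 0) := by
    induction p using Polynomial.induction_on' with
    | add p r hp hr =>
      have := hp.add hr
      simp only [Polynomial.eval_add, Nat.cast_add, add_div]
      simpa using this
    | monomial d c =>
      have := (tendsto_pow_const_div_const_pow_of_one_lt d (r := (2 : ℝ)) (by norm_num)).const_mul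
        (c : ℝ)
      simpa [Polynomial.eval_monomial, mul_div_assoc] using this
  filter_upwards [h.eventually_lt_const zero_lt_one] with q hq
  rw [div_lt_one (by positivity)] at hq
  exact_mod_cast hq

theorem not_polyBounded_of_two_pow_lt {g : ℕ → ℕ} (h : ∀ q, 2 ≤ q → 2 ^ q < g (q + 2) + (q + 2)) :
    ¬ PolyBounded g := by
  rintro ⟨p, hp⟩
  obtain ⟨q, h1, h2⟩ := ((eventually_eval_lt_two_pow
    (p.comp (Polynomial.X + 2) + (Polynomial.X + 2))).and (Filter.eventually_ge_atTop 2)).exists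
  have h3 := h q h2
  have h4 := hp (q + 2)
  simp [Polynomial.eval_comp] at h1
  omega

theorem not_polyBounded_modulus {m : ℕ → ℕ → ℕ} (hm : IsModulus contractRay m) :
    (∀ n : ℕ, ¬ PolyBounded (fun k => m k n)) ∧ (∀ k : ℕ, ¬ PolyBounded (fun n => m k n)) := by
  refine ⟨fun n => not_polyBounded_of_two_pow_lt fun q hq => ?_,
    fun k => not_polyBounded_of_two_pow_lt fun q _ => ?_⟩
  -- With `j = k = q + 2` the values differ by 2, and the pair stays below 1 + 2^k because `q + 2 ≤
  -- 2 ^ q` for `q ≥ 2`.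
  · refine hm.lt_of_steep (j := q + 2) ?_ ?_
    · have h1 : q + 2 ≤ 2 ^ q := by
        induction q, hq using Nat.le_induction with
        | base => norm_num
        | succ q hq ih => rw [pow_succ]; omega
      have : (2 : ℚ) ^ (q + 2) / 2 ^ 2 ^ q ≤ 1 := by
        rw [div_le_one (by positivity)]
        exact pow_le_pow_right₀ (by norm_num) h1
      linarith
    · have e : (2 : ℚ) ^ (q + 2) / 2 ^ (q + 1) = 2 := by rw [pow_succ _ (q + 1)]; field_simp
      rw [e]
      exact (pow_le_one₀ (by norm_num) (by norm_num)).trans_lt (by norm_num)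
  · refine (hm.lt_of_steep (j := 0) (k := k) (n := q + 2) (q := q) ?_ ?_).trans_le (by omega)
    · have h1 : (1 : ℚ) / 2 ^ 2 ^ q ≤ 1 := by
        rw [div_le_one (by positivity)]
        exact one_le_pow₀ (by norm_num)
      have h2 : (1 : ℚ) ≤ 2 ^ k := one_le_pow₀ (by norm_num)
      rw [pow_zero]
      linarith
    · rw [one_div, inv_pow, pow_zero, one_div]
      gcongr <;> norm_num

/-! ### `contract` as a left-to-right transformation of digits -/

/-- The effect of `contract` on the digits behind the leading digit `1`, up to zeros at the end,
read from left to right. The number of digits read so far is `2 ^ s + r`, `r < 2 ^ s`. -/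
def contractDigits : ℕ → ℕ → List Bool → List Bool
  | _, _, [] => []
  | _, r, true :: l => true :: if r = 0 then l else []
  | s, r, false :: l =>
    if r + 1 = 2 ^ s then false :: contractDigits (s + 1) 0 l else contractDigits s (r + 1) l

theorem length_contractDigits_le (s r : ℕ) (l : List Bool) :
    (contractDigits s r l).length ≤ l.length := by
  induction l generalizing s r with
  | nil => simp [contractDigits]
  | cons b l ih =>
    have h1 := ih (s + 1) 0
    have h2 := ih s (r + 1)
    cases b <;> simp only [contractDigits] <;> split_ifs <;> simp <;> omega

theorem contractDigits_replicate (s r n : ℕ) :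
    ∃ m ≤ n, contractDigits s r (List.replicate n false) = List.replicate m false := by
  induction n generalizing s r with
  | zero => exact ⟨0, le_rfl, rfl⟩
  | succ n ih =>
    rw [List.replicate_succ, contractDigits]
    split_ifs
    · obtain ⟨m, hm, h⟩ := ih (s + 1) 0
      exact ⟨m + 1, by omega, by rw [h, List.replicate_succ]⟩
    · obtain ⟨m, hm, h⟩ := ih s (r + 1)
      exact ⟨m, by omega, h⟩

/-- One zero is emitted for each dyadic block [2^s, 2^(s+1)) of positions that is passed completely.
The first 1 is at position `2 ^ s + r + n`, in block `q`, so `q - s` zeros precede it. -/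
theorem contractDigits_replicate_append {s r n q : ℕ} {l : List Bool} (hr : r < 2 ^ s)
    (h1 : 2 ^ q ≤ 2 ^ s + r + n) (h2 : 2 ^ s + r + n < 2 ^ (q + 1)) :
    contractDigits s r (List.replicate n false ++ true :: l) =
      List.replicate (q - s) false ++ true :: if 2 ^ s + r + n = 2 ^ q then l else [] := by
  induction n generalizing s r with
  | zero =>
    have hq : q = s := by
      have h3 : q < s + 1 := (Nat.pow_lt_pow_iff_right (a := 2) (by norm_num)).1
        (by rw [pow_succ]; omega)
      have h4 : s < q + 1 := (Nat.pow_lt_pow_iff_right (a := 2) (by norm_num)).1 (by omega)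
      omega
    subst hq
    simp [contractDigits]
  | succ n ih =>
    rw [List.replicate_succ, List.cons_append, contractDigits]
    split_ifs with h3 h4 h4
    · have hs : s < q := by
        have : s + 1 < q + 1 := (Nat.pow_lt_pow_iff_right (a := 2) (by norm_num)).1
          (by rw [pow_succ]; omega)
        omega
      have e : q - s = (q - (s + 1)) + 1 := by omega
      rw [ih (Nat.two_pow_pos _) (by rw [pow_succ]; omega) (by rw [pow_succ]; omega), e,
        List.replicate_succ, if_pos (by rw [pow_succ]; omega)]
      rfl
    · have hs : s < q := by
        have : s + 1 < q + 1 := (Nat.pow_lt_pow_iff_right (a := 2) (by norm_num)).1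
          (by rw [pow_succ]; omega)
        omega
      have e : q - s = (q - (s + 1)) + 1 := by omega
      rw [ih (Nat.two_pow_pos _) (by rw [pow_succ]; omega) (by rw [pow_succ]; omega), e,
        List.replicate_succ, if_neg (by rw [pow_succ]; omega)]
      rfl
    · rw [ih (by omega) (by omega) (by omega), if_pos (by omega)]
    · rw [ih (by omega) (by omega) (by omega), if_neg (by omega)]

theorem eq_replicate_false_or (l : List Bool) : (∃ n, l = List.replicate n false) ∨
    ∃ n l', l = List.replicate n false ++ true :: l' := by
  induction l with
  | nil => exact Or.inl ⟨0, rfl⟩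
  | cons b l ih =>
    cases b
    · rcases ih with ⟨n, rfl⟩ | ⟨n, l', rfl⟩
      · exact Or.inl ⟨n + 1, rfl⟩
      · exact Or.inr ⟨n + 1, l', rfl⟩
    · exact Or.inr ⟨0, l, rfl⟩

/-- Padding with zeros to the original length restores the place values, as `contract` preserves the
number of digits. -/
theorem bitVal_contractDigits (l : List Bool) :
    bitVal (true :: contractDigits 0 0 l ++
      List.replicate (l.length - (contractDigits 0 0 l).length) false) =
      contract (bitVal (true :: l)) := by
  rcases eq_replicate_false_or l with ⟨n, rfl⟩ | ⟨n, l, rfl⟩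
  · obtain ⟨m, hm, h⟩ := contractDigits_replicate 0 0 n
    rw [h, List.cons_append, ← List.replicate_add, bitVal, bitVal, bitVal_replicate_false,
      bitVal_replicate_false]
    simp only [List.length_replicate, Bool.toNat_true, one_mul, add_zero]
    rw [contract_two_pow, Nat.add_sub_of_le hm]
  · have hq1 : 2 ^ Nat.log 2 (n + 1) ≤ n + 1 := Nat.pow_log_le_self 2 (by omega)
    have hq2 : n + 1 < 2 ^ (Nat.log 2 (n + 1) + 1) := Nat.lt_pow_succ_log_self (by norm_num) _
    have hw : bitVal (true :: l) < 2 ^ (l.length + 1) := bitVal_lt _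
    have hqn := succ_le_of_two_pow_le hq1
    rw [contractDigits_replicate_append (q := Nat.log 2 (n + 1)) (by norm_num)
      (by rw [pow_zero]; omega) (by rw [pow_zero]; omega)]
    have e : bitVal (true :: (List.replicate n false ++ true :: l)) =
        2 ^ (l.length + (n + 1)) + bitVal (true :: l) := by
      rw [bitVal, bitVal_append, bitVal_replicate_false]
      simp
      ring
    rw [e, contract_add (two_pow_le_bitVal l) hw (by omega) hq1 hq2, bitVal_append,
      bitVal_replicate_false]
    generalize Nat.log 2 (n + 1) = q at *
    have e2 : 2 ^ 0 + 0 + n = n + 1 := by omega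
    rw [e2]
    split_ifs
    · have e3 : n + 1 - q - 1 = n - q := by omega
      have e4 : n + (l.length + 1) - (q + (l.length + 1)) = n - q := by omega
      rw [bitVal, bitVal_append, bitVal_replicate_false]
      simp only [List.length_append, List.length_replicate, List.length_cons, e3, e4, Nat.sub_zero]
      simp only [Bool.toNat_true, one_mul, zero_mul, zero_add, add_zero, add_mul, ← pow_add]
      congr 2
      omega
    · have e3 : n + (l.length + 1) - (q + 1) = l.length + (n + 1) - q - 1 := by omega
      rw [bitVal, bitVal_append, bitVal_replicate_false]
      simp [bitVal, e3, add_mul, ← pow_add]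
      omega

theorem getLast_contractDigits {l : List Bool} (h : ∀ b ∈ l.getLast?, b = true) :
    ∀ b ∈ (contractDigits 0 0 l).getLast?, b = true := by
  rcases eq_replicate_false_or l with ⟨n, rfl⟩ | ⟨n, l, rfl⟩
  · cases n with
    | zero => simp [contractDigits]
    | succ n => simp [List.getLast?_replicate] at h
  · rw [contractDigits_replicate_append (q := Nat.log 2 (n + 1)) (by norm_num)
      (by rw [pow_zero, add_zero, add_comm]; exact Nat.pow_log_le_self 2 (by omega))
      (by rw [pow_zero, add_zero, add_comm]; exact Nat.lt_pow_succ_log_self (by norm_num) _)]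
    split_ifs
    · simpa [List.getLast?_append, List.getLast?_cons] using h
    · simp

/-! ### Codes of input and output numerals -/

/-- The code of a list of digits. -/
def digitsCode (l : List Bool) : List Bool :=
  l.flatMap fun b => [b, b]

/-- The code of a list of digits with a point behind the first `i` digits, if there are more. -/
def layout (i : ℕ) (l : List Bool) : List Bool :=
  if l.length ≤ i then digitsCode l
  else digitsCode (l.take i) ++ [true, false] ++ digitsCode (l.drop i)

theorem flatMap_code_ofBit (l : List Bool) :
    (l.map Sym.ofBit).flatMap Sym.code = digitsCode l := by
  induction l with
  | nil => rfl
  | cons b l ih => cases b <;> simp [digitsCode, Sym.ofBit, Sym.code] at ih ⊢ <;> exact ih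

theorem HasDigits.encode_eq {d : Dyadic} {l l' : List Bool} (h : HasDigits d l l') :
    encode d = digitsCode (true :: l) ++
      if l' = [] then [] else [true, false] ++ digitsCode l' := by
  rw [encode, h.numeral_eq, List.flatMap_append, flatMap_code_ofBit]
  split_ifs
  · rfl
  · rw [List.flatMap_cons, flatMap_code_ofBit]; rfl

/-- The point keeps its place. Either the new digits reach beyond it and end in 1, or the result is
an integer, to be filled up with zeros as far as the point. -/
theorem encode_contractRay {d : Ray 1} {l l' : List Bool} (h : HasDigits d.1 l l') :
    encode (contractRay d) = layout (l.length + 1)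
      (true :: contractDigits 0 0 (l ++ l') ++
        List.replicate (l.length - (contractDigits 0 0 (l ++ l')).length) false) := by
  have hv : (contractRay d).toRat = (contract (bitVal (true :: (l ++ l'))) : ℚ) / 2 ^ l'.length :=
    toRat_contractRay (Nat.one_le_two_pow.trans (two_pow_le_bitVal _)) h.toRat_eq
  have hlen := length_contractDigits_le 0 0 (l ++ l')
  rw [← bitVal_contractDigits] at hv
  -- An integer input may end in zeros, so the last digit is known to be 1 only if there is a
  -- fractional part.
  have hlast : l' ≠ [] → ∀ b ∈ (contractDigits 0 0 (l ++ l')).getLast?, b = true := fun hne => by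
    apply getLast_contractDigits
    rw [List.getLast?_append_of_ne_nil _ hne]
    exact h.last
  generalize contractDigits 0 0 (l ++ l') = X at *
  rw [List.length_append] at hlen hv
  rcases Nat.lt_or_ge l.length X.length with hl | hl
  · have hne : l' ≠ [] := by rintro rfl; simp at hlen; omega
    have hd : HasDigits (contractRay d) (X.take l.length) (X.drop l.length) := by
      refine ⟨?_, fun b hb => hlast hne b ?_⟩
      · have e0 : true :: X.take l.length ++ X.drop l.length = true :: X := by simp
        rw [hv, e0, bitVal_append, bitVal_replicate_false,
          List.length_replicate, List.length_drop]
        have e : l'.length = (l.length + l'.length - X.length) + (X.length - l.length) := by omega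
        rw [add_zero]
        conv_lhs => rw [e, pow_add]
        have e2 : l.length + ((l.length + l'.length - X.length) + (X.length - l.length)) -
          X.length = l.length + l'.length - X.length := by omega
        rw [e2]
        push_cast
        field_simp
      · rw [List.getLast?_drop] at hb
        split_ifs at hb with hc
        · simp at hb
        · exact hb
    have hdne : X.drop l.length ≠ [] := by simpa using hl
    rw [hd.encode_eq, if_neg hdne, Nat.sub_eq_zero_of_le hl.le, layout,
      if_neg (by simpa using hl)]
    simp
  · have hd : HasDigits (contractRay d) (X ++ List.replicate (l.length - X.length) false) [] := by
      refine ⟨?_, by simp⟩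
      have e : l.length + l'.length - X.length = (l.length - X.length) + l'.length := by omega
      rw [hv, e, List.replicate_add, ← List.append_assoc, bitVal_append _ (List.replicate _ false),
        bitVal_replicate_false]
      simp
    rw [hd.encode_eq, if_pos rfl, layout, if_pos (by simp; omega)]
    simp

/-! ### The stack program -/

/-- The stacks: input and output, the reversed output, the integer positions that have been read and
not yet been written (above a marker `false` for the point), and two counters. -/
inductive Stk where
  | io
  | rev
  | pend
  | cnt (c : Bool)
  deriving DecidableEq, Fintype

/-- The labels of the program. -/
inductive Lbl where
  | start
  | run (c : Bool)
  | copy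
  | skip
  | pad
  | out
  | clear
  deriving Fintype

/-- Two registers for symbols, and whether the point has been read. -/
abbrev Reg : Type := Option Bool × Option Bool × Bool

/-- The statements of the program. -/
abbrev Stm : Type := TM2.Stmt (fun _ : Stk => Bool) Lbl Reg

/-- The configurations of the program. -/
abbrev Conf : Type := TM2.Cfg (fun _ : Stk => Bool) Lbl Reg

open TM2.Stmt

/-- Move the top of a stack to the first register. -/
def popFst (k : Stk) (q : Stm) : Stm := pop k (fun v o => (o, v.2)) q

/-- Move the top of a stack to the second register. -/
def popSnd (k : Stk) (q : Stm) : Stm := pop k (fun v o => (v.1, o, v.2.2)) q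

/-- Copy the top of a stack to the second register. -/
def peekSnd (k : Stk) (q : Stm) : Stm := peek k (fun v o => (v.1, o, v.2.2)) q

/-- Clear the registers and jump. -/
def jump (l : Lbl) : Stm := load (fun v => (none, none, v.2.2)) (goto fun _ => l)

/-- Read a digit to the first register; repeat `l` if it is the point, go to `Lbl.pad` if there is
none. -/
def readDigit (l : Lbl) (q : Stm) : Stm :=
  popFst .io <| popSnd .io <|
  branch (fun v => v.1.isNone) (load (fun _ => (none, none, false)) (goto fun _ => .pad)) <|
  branch (fun v => v.1 != v.2.1) (load (fun _ => (none, none, true)) (goto fun _ => l)) <|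
  branch (fun v => v.2.2) q (push .pend (fun _ => true) q)

/-- Write the digit in the first register, after the point if all integer positions are
written. -/
def writeDigit (q : Stm) : Stm :=
  popSnd .pend <| branch (fun v => v.2.1 == some false)
    (push .rev (fun _ => true) <| push .rev (fun _ => false) <|
      push .rev (fun v => v.1 == some true) <| push .rev (fun v => v.1 == some true) q)
    (push .rev (fun v => v.1 == some true) <| push .rev (fun v => v.1 == some true) q)

/-- Process the digit in the first register in `Lbl.run c`. -/
def runBody (c : Bool) : Stm :=
  branch (fun v => v.1 == some true)
    (writeDigit <| peekSnd (.cnt !c) <| branch (fun v => v.2.1.isNone) (jump .copy) (jump .skip))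
    (popSnd (.cnt c) <| push (.cnt !c) (fun _ => true) <| push (.cnt !c) (fun _ => true) <|
      peekSnd (.cnt c) <| branch (fun v => v.2.1.isNone)
        (writeDigit <| jump (.run !c)) (jump (.run c)))

/-- A program for `contractRay`. In `Lbl.run c`, after `2 ^ s + r` digits, the counters `c` and `!c`
contain `2 ^ s - r` and `2 * r`. -/
def program : Lbl → Stm
  | .start => popFst .io <| popFst .io <| push .pend (fun _ => false) <|
      push .rev (fun _ => true) <| push .rev (fun _ => true) <|
      push (.cnt false) (fun _ => true) <| jump (.run false)
  | .run c => readDigit (.run c) (runBody c)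
  | .copy => readDigit .copy <| writeDigit <| jump .copy
  | .skip => readDigit .skip <| jump .skip
  | .pad => popFst .pend <| branch (fun v => v.1 == some true)
      (push .rev (fun _ => false) <| push .rev (fun _ => false) <| jump .pad) (jump .out)
  | .out => popFst .rev <| branch (fun v => v.1.isNone) (jump .clear)
      (push .io (fun v => v.1 == some true) <| jump .out)
  | .clear => popFst (.cnt false) <| popSnd (.cnt true) <|
      branch (fun v => v.1.isNone && v.2.1.isNone) (load (fun _ => (none, none, false)) halt)
        (jump .clear)

/-- The contents of the stacks. -/
def stks (io rev pend : List Bool) (c : Bool) (p q : List Bool) : Stk → List Bool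
  | .io => io
  | .rev => rev
  | .pend => pend
  | .cnt b => if b = c then p else q

section
variable (io rev pend : List Bool) (c : Bool) (p q l : List Bool)

@[simp] theorem stks_io : stks io rev pend c p q .io = io := rfl
@[simp] theorem stks_rev : stks io rev pend c p q .rev = rev := rfl
@[simp] theorem stks_pend : stks io rev pend c p q .pend = pend := rfl
@[simp] theorem stks_cnt : stks io rev pend c p q (.cnt c) = p := by simp [stks]
@[simp] theorem stks_cnt_not : stks io rev pend c p q (.cnt !c) = q := by simp [stks]

@[simp] theorem update_stks_io :
    Function.update (stks io rev pend c p q) .io l = stks l rev pend c p q := by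
  funext k; cases k <;> simp [stks, Function.update]
@[simp] theorem update_stks_rev :
    Function.update (stks io rev pend c p q) .rev l = stks io l pend c p q := by
  funext k; cases k <;> simp [stks, Function.update]
@[simp] theorem update_stks_pend :
    Function.update (stks io rev pend c p q) .pend l = stks io rev l c p q := by
  funext k; cases k <;> simp [stks, Function.update]
@[simp] theorem update_stks_cnt :
    Function.update (stks io rev pend c p q) (.cnt c) l = stks io rev pend c l q := by
  funext k; cases k <;> simp [stks, Function.update]; split_ifs <;> rfl
@[simp] theorem update_stks_cnt_not :
    Function.update (stks io rev pend c p q) (.cnt !c) l = stks io rev pend c p l := by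
  funext k
  rcases k with _ | _ | _ | b
  · rfl
  · rfl
  · rfl
  · cases b <;> cases c <;> simp [stks, Function.update]

theorem stks_swap : stks io rev pend c p q = stks io rev pend (!c) q p := by
  funext k
  rcases k with _ | _ | _ | b
  · rfl
  · rfl
  · rfl
  · cases b <;> cases c <;> rfl

end

/-! ### Correctness and step counts of the phases -/

/-- The program goes from one configuration to the other in `n` steps. -/
def StepsTo (n : ℕ) (a b : Conf) : Prop :=
  (flip bind (TM2.step program))^[n] (some a) = some b

theorem StepsTo.refl (a : Conf) : StepsTo 0 a a := rfl

theorem StepsTo.head {n : ℕ} {l : Lbl} {v : Reg} {S : Stk → List Bool} {a b : Conf}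
    (h : TM2.stepAux (program l) v S = a) (h' : StepsTo n a b) : StepsTo (n + 1) ⟨some l, v, S⟩ b := by
  subst h
  exact h'

theorem StepsTo.trans {m n : ℕ} {a b c : Conf} (h : StepsTo m a b) (h' : StepsTo n b c) :
    StepsTo (n + m) a c := by
  unfold StepsTo at *
  rw [Function.iterate_add_apply, h, h']

/-- The pending integer positions, if `i` integer digits have been read and `e` written. -/
def pending (i : ℕ) (e : List Bool) : List Bool :=
  if e.length ≤ i then List.replicate (i - e.length) true ++ [false] else []

/-- The stacks if `i` integer digits have been read and `e` written. -/
def workStks (io : List Bool) (i : ℕ) (e : List Bool) (c : Bool) (p q : List Bool) :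
    Stk → List Bool :=
  stks io (layout i e).reverse (pending i e) c p q

/-- The code of a numeral without minus sign, where `none` is the point. -/
def numCode (l : List (Option Bool)) : List Bool :=
  l.flatMap fun o => o.elim [true, false] fun b => [b, b]

/-- The number of digits before the point; `g` tells whether the point has been read. -/
def intCount : Bool → List (Option Bool) → ℕ
  | _, [] => 0
  | _, none :: l => intCount true l
  | g, some _ :: l => (!g).toNat + intCount g l

theorem digitsCode_append (l l' : List Bool) :
    digitsCode (l ++ l') = digitsCode l ++ digitsCode l' := by
  simp [digitsCode]

/-- The top of the pending stack tells the three cases apart: an unfilled integer position, the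
marker (the point is due now), or nothing (the point is already written). -/
theorem stepAux_writeDigit (s : Stm) (b : Bool) (z : Option Bool) (g : Bool) (io : List Bool)
    (i : ℕ) (e : List Bool) (c : Bool) (p q : List Bool) :
    TM2.stepAux (writeDigit s) (some b, z, g) (workStks io i e c p q) =
      TM2.stepAux s (some b, (pending i e).head?, g) (workStks io i (e ++ [b]) c p q) := by
  rcases lt_trichotomy e.length i with h | h | h
  · obtain ⟨j, rfl⟩ := Nat.exists_eq_add_of_lt h
    have h0 : e.length ≤ e.length + j + 1 := by omega
    have h1 : e.length + j + 1 - e.length = j + 1 := by omega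
    have h2 : e.length + j + 1 - (e.length + 1) = j := by omega
    cases b <;> simp [writeDigit, popSnd, workStks, pending, layout, h0, h1, h2, digitsCode_append,
      List.replicate_succ] <;> simp [digitsCode]
  · subst h
    cases b <;> simp [writeDigit, popSnd, workStks, pending, layout] <;> simp [digitsCode]
  · have h1 : ¬ e.length ≤ i := by omega
    have h2 : ¬ e.length + 1 ≤ i := by omega
    have h3 : i - e.length = 0 := by omega
    cases b <;> simp [writeDigit, popSnd, workStks, pending, layout, h1, h2, List.take_append,
      List.drop_append, h3, digitsCode_append] <;> simp [digitsCode]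

theorem stepAux_readDigit_nil (l : Lbl) (s : Stm) (g : Bool) (i : ℕ) (e : List Bool) (c : Bool)
    (p q : List Bool) :
    TM2.stepAux (readDigit l s) (none, none, g) (workStks [] i e c p q) =
      ⟨some .pad, (none, none, false), workStks [] i e c p q⟩ := by
  simp [readDigit, popFst, popSnd, workStks]

theorem stepAux_readDigit_none (l : Lbl) (s : Stm) (g : Bool) (io : List Bool) (i : ℕ)
    (e : List Bool) (c : Bool) (p q : List Bool) :
    TM2.stepAux (readDigit l s) (none, none, g) (workStks (true :: false :: io) i e c p q) =
      ⟨some l, (none, none, true), workStks io i e c p q⟩ := by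
  simp [readDigit, popFst, popSnd, workStks]
  rfl

/-- Before the point is read, output must not overtake input: `hg` ensures that the marker is still
at the bottom of the pending stack when a position is pushed. -/
theorem stepAux_readDigit_some (l : Lbl) (s : Stm) (b g : Bool) (io : List Bool) (i : ℕ)
    (e : List Bool) (c : Bool) (p q : List Bool) (hg : g = false → e.length ≤ i) :
    TM2.stepAux (readDigit l s) (none, none, g) (workStks (b :: b :: io) i e c p q) =
      TM2.stepAux s (some b, some b, g) (workStks io (i + (!g).toNat) e c p q) := by
  cases g
  · have h := hg rfl
    have h1 : e.length ≤ i + 1 := by omega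
    have h2 : i + 1 - e.length = (i - e.length) + 1 := by omega
    simp [readDigit, popFst, popSnd, workStks, layout, pending, h, h1, h2, List.replicate_succ]
  · simp [readDigit, popFst, popSnd, workStks]

theorem stepAux_runBody_true (z : Option Bool) (g : Bool) (io : List Bool) (i : ℕ) (e : List Bool)
    (c : Bool) (p q : List Bool) :
    TM2.stepAux (runBody c) (some true, z, g) (workStks io i e c p q) =
      ⟨some (if q = [] then .copy else .skip), (none, none, g),
        workStks io i (e ++ [true]) c p q⟩ := by
  simp only [runBody, TM2.stepAux, stepAux_writeDigit, BEq.rfl, cond_true]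
  cases q <;> simp [peekSnd, jump, workStks]

/-- An emptied counter marks the end of a block: a zero is written and the counters exchange roles.
-/
theorem stepAux_runBody_false (z : Option Bool) (g : Bool) (io : List Bool) (i : ℕ) (e : List Bool)
    (c b : Bool) (p q : List Bool) :
    TM2.stepAux (runBody c) (some false, z, g) (workStks io i e c (b :: p) q) =
      if p = [] then ⟨some (.run !c), (none, none, g),
        workStks io i (e ++ [false]) (!c) (true :: true :: q) []⟩
      else ⟨some (.run c), (none, none, g), workStks io i e c p (true :: true :: q)⟩ := by
  have h : TM2.stepAux (runBody c) (some false, z, g) (workStks io i e c (b :: p) q) =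
      TM2.stepAux (branch (fun v => v.2.1.isNone) (writeDigit <| jump (.run !c)) (jump (.run c)))
        (some false, p.head?, g) (workStks io i e c p (true :: true :: q)) := by
    simp [runBody, popSnd, peekSnd, workStks]
  rw [h]
  cases p with
  | nil =>
    simp only [TM2.stepAux, stepAux_writeDigit, List.head?_nil, Option.isNone_none, cond_true]
    simp [jump, workStks, stks_swap _ _ _ c]
  | cons b p => simp [jump]

theorem stepsTo_copy (items : List (Option Bool)) {g : Bool} {i : ℕ} {e : List Bool} (c : Bool)
    (p q : List Bool) (hg : g = false → e.length ≤ i) :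
    StepsTo (items.length + 1)
      ⟨some .copy, (none, none, g), workStks (numCode items) i e c p q⟩
      ⟨some .pad, (none, none, false),
        workStks [] (i + intCount g items) (e ++ items.reduceOption) c p q⟩ := by
  induction items generalizing g i e with
  | nil =>
    refine StepsTo.head (stepAux_readDigit_nil _ _ _ _ _ _ _ _) ?_
    simpa [intCount] using StepsTo.refl _
  | cons o items ih =>
    rcases o with _ | b
    · refine StepsTo.head (stepAux_readDigit_none _ _ _ _ _ _ _ _ _) ?_
      exact ih (by simp)
    · refine StepsTo.head (a := ⟨some .copy, (none, none, g),
        workStks (numCode items) (i + (!g).toNat) (e ++ [b]) c p q⟩) ?_ ?_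
      · refine (stepAux_readDigit_some _ _ _ _ _ _ _ _ _ _ hg).trans ?_
        rw [stepAux_writeDigit]
        simp [jump]; rfl
      · have := ih (g := g) (i := i + (!g).toNat) (e := e ++ [b])
          (by rintro rfl; simpa using hg rfl)
        simpa [intCount, add_assoc] using this

/-- Dropped digits must still be read: those before the point are integer positions to be padded
with zeros later. -/
theorem stepsTo_skip (items : List (Option Bool)) {g : Bool} {i : ℕ} {e : List Bool} (c : Bool)
    (p q : List Bool) (hg : g = false → e.length ≤ i) :
    StepsTo (items.length + 1)
      ⟨some .skip, (none, none, g), workStks (numCode items) i e c p q⟩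
      ⟨some .pad, (none, none, false), workStks [] (i + intCount g items) e c p q⟩ := by
  induction items generalizing g i with
  | nil =>
    refine StepsTo.head (stepAux_readDigit_nil _ _ _ _ _ _ _ _) ?_
    simpa [intCount] using StepsTo.refl _
  | cons o items ih =>
    rcases o with _ | b
    · refine StepsTo.head (stepAux_readDigit_none _ _ _ _ _ _ _ _ _) ?_
      exact ih (by simp)
    · refine StepsTo.head (a := ⟨some .skip, (none, none, g),
        workStks (numCode items) (i + (!g).toNat) e c p q⟩) ?_ ?_
      · refine (stepAux_readDigit_some _ _ _ _ _ _ _ _ _ _ hg).trans ?_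
        simp [jump]; rfl
      · have := ih (g := g) (i := i + (!g).toNat)
          (by rintro rfl; have := hg rfl; simp; omega)
        simpa [intCount, add_assoc] using this

/-- The counters `2 ^ s - r` and `2 * r` encode the position: the first is used up exactly at the
end of the block, when the second holds `2 ^ (s + 1)`, the size of the next one. The second is empty
iff `r = 0`, which decides between copying and skipping. -/
theorem stepsTo_run (items : List (Option Bool)) {g : Bool} {i : ℕ} {e : List Bool} (c : Bool)
    {s r : ℕ} (hr : r < 2 ^ s) (hg : g = false → e.length ≤ i) :
    ∃ c' p q, p.length + q.length ≤ 2 ^ s + r + items.length ∧ StepsTo (items.length + 1)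
      ⟨some (.run c), (none, none, g), workStks (numCode items) i e c
        (List.replicate (2 ^ s - r) true) (List.replicate (2 * r) true)⟩
      ⟨some .pad, (none, none, false), workStks [] (i + intCount g items)
        (e ++ contractDigits s r items.reduceOption) c' p q⟩ := by
  induction items generalizing g i e c s r with
  | nil =>
    refine ⟨c, List.replicate (2 ^ s - r) true, List.replicate (2 * r) true, by simp; omega,
      StepsTo.head (stepAux_readDigit_nil _ _ _ _ _ _ _ _) ?_⟩
    simpa [intCount, contractDigits] using StepsTo.refl _
  | cons o items ih =>
    rcases o with _ | b
    · obtain ⟨c', p, q, h1, h2⟩ := ih (g := true) (i := i) (e := e) c hr (by simp)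
      refine ⟨c', p, q, by simp; omega, StepsTo.head (stepAux_readDigit_none _ _ _ _ _ _ _ _ _) ?_⟩
      exact h2
    have hread := stepAux_readDigit_some (.run c) (runBody c) b g (numCode items) i e c
      (List.replicate (2 ^ s - r) true) (List.replicate (2 * r) true) hg
    cases b
    · obtain ⟨j, hj⟩ : ∃ j, 2 ^ s - r = j + 1 := ⟨2 ^ s - r - 1, by omega⟩
      rw [hj, List.replicate_succ] at hread ⊢
      have hstep := hread.trans (stepAux_runBody_false _ _ _ _ _ _ _ _ _)
      have e2 : true :: true :: List.replicate (2 * r) true = List.replicate (2 * (r + 1)) true :=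
        rfl
      rw [e2] at hstep
      by_cases h : r + 1 = 2 ^ s
      · obtain rfl : j = 0 := by omega
        obtain ⟨c', p, q, h1, h2⟩ := ih (g := g) (i := i + (!g).toNat) (e := e ++ [false]) (!c)
          (s := s + 1) (r := 0) (Nat.two_pow_pos _) (by rintro rfl; simpa using hg rfl)
        refine ⟨c', p, q, by rw [pow_succ] at h1; simp; omega, StepsTo.head hstep ?_⟩
        have e3 : 2 ^ (s + 1) - 0 = 2 * (r + 1) := by rw [pow_succ]; omega
        rw [e3] at h2
        simpa [intCount, contractDigits, h, add_assoc] using h2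
      · obtain ⟨c', p, q, h1, h2⟩ := ih (g := g) (i := i + (!g).toNat) (e := e) c
          (s := s) (r := r + 1) (by omega) (by rintro rfl; have := hg rfl; simp; omega)
        refine ⟨c', p, q, by simp; omega, StepsTo.head hstep ?_⟩
        have e3 : 2 ^ s - (r + 1) = j := by omega
        rw [e3] at h2
        have hj0 : j ≠ 0 := by omega
        simpa [intCount, contractDigits, h, add_assoc, hj0] using h2
    · refine ⟨c, List.replicate (2 ^ s - r) true, List.replicate (2 * r) true, by simp; omega,
        StepsTo.head (hread.trans (stepAux_runBody_true _ _ _ _ _ _ _ _)) ?_⟩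
      have hg' : g = false → (e ++ [true]).length ≤ i + (!g).toNat := by
        rintro rfl; simpa using hg rfl
      by_cases h : r = 0
      · have := stepsTo_copy items c (List.replicate (2 ^ s - r) true) (List.replicate (2 * r) true)
          hg'
        simpa [intCount, contractDigits, h, add_assoc] using this
      · have := stepsTo_skip items c (List.replicate (2 ^ s - r) true) (List.replicate (2 * r) true)
          hg'
        simpa [intCount, contractDigits, h, add_assoc] using this

theorem stepsTo_pad_replicate (rev : List Bool) (n : ℕ) (c : Bool) (p q : List Bool) :
    StepsTo (n + 1) ⟨some .pad, (none, none, false),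
        stks [] rev (List.replicate n true ++ [false]) c p q⟩
      ⟨some .out, (none, none, false),
        stks [] ((digitsCode (List.replicate n false)).reverse ++ rev) [] c p q⟩ := by
  induction n generalizing rev with
  | zero =>
    refine StepsTo.head ?_ (StepsTo.refl _)
    simp [program, popFst, jump, digitsCode]
  | succ n ih =>
    refine StepsTo.head (a := ⟨some .pad, (none, none, false),
      stks [] (false :: false :: rev) (List.replicate n true ++ [false]) c p q⟩) ?_ ?_
    · simp [program, popFst, jump, List.replicate_succ]
    · have := ih (false :: false :: rev)
      simpa [List.replicate_succ, digitsCode] using this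

theorem stepsTo_pad (i : ℕ) (e : List Bool) (c : Bool) (p q : List Bool) :
    StepsTo (i - e.length + 1) ⟨some .pad, (none, none, false), workStks [] i e c p q⟩
      ⟨some .out, (none, none, false),
        stks [] (layout i (e ++ List.replicate (i - e.length) false)).reverse [] c p q⟩ := by
  by_cases h : e.length ≤ i
  · have := stepsTo_pad_replicate (digitsCode e).reverse (i - e.length) c p q
    simpa [workStks, pending, layout, h, digitsCode_append] using this
  · have h1 : i - e.length = 0 := by omega
    rw [h1, List.replicate_zero, List.append_nil]
    refine StepsTo.head ?_ (StepsTo.refl _)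
    simp [program, popFst, jump, workStks, pending, h]

theorem stepsTo_out (rev io : List Bool) (c : Bool) (p q : List Bool) :
    StepsTo (rev.length + 1) ⟨some .out, (none, none, false), stks io rev [] c p q⟩
      ⟨some .clear, (none, none, false), stks (rev.reverse ++ io) [] [] c p q⟩ := by
  induction rev generalizing io with
  | nil =>
    refine StepsTo.head ?_ (StepsTo.refl _)
    simp [program, popFst, jump]
  | cons b rev ih =>
    refine StepsTo.head (a := ⟨some .out, (none, none, false), stks (b :: io) rev [] c p q⟩) ?_ ?_
    · cases b <;> simp [program, popFst, jump]
    · simpa using ih (b :: io)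

/-- The halting configuration requires all stacks but the output to be empty, so the leftover
counters are removed. -/
theorem stepsTo_clear (io : List Bool) (c : Bool) (p q : List Bool) :
    ∃ n ≤ p.length + q.length + 1,
      StepsTo n ⟨some .clear, (none, none, false), stks io [] [] c p q⟩
        ⟨none, (none, none, false), stks io [] [] false [] []⟩ := by
  wlog hc : c = false generalizing c p q
  · obtain ⟨n, h1, h2⟩ := this (!c) q p (by simpa using hc)
    exact ⟨n, by omega, by rwa [stks_swap]⟩
  subst hc
  have hclear : ∀ p q : List Bool,
      TM2.stepAux (program .clear) (none, none, false) (stks io [] [] false p q) =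
        if p = [] ∧ q = [] then ⟨none, (none, none, false), stks io [] [] false [] []⟩
        else ⟨some .clear, (none, none, false), stks io [] [] false p.tail q.tail⟩ := by
    intro p q
    have h1 := stks_cnt_not io [] [] false p.tail q
    have h2 := update_stks_cnt_not io [] [] false p.tail q q.tail
    rw [Bool.not_false] at h1 h2
    cases p <;> cases q <;> simp_all [program, popFst, popSnd, jump]
  induction hn : p.length + q.length using Nat.strong_induction_on generalizing p q with
  | _ n ih =>
    by_cases h : p = [] ∧ q = []
    · exact ⟨1, by omega, StepsTo.head (by rw [hclear, if_pos h]) (StepsTo.refl _)⟩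
    · have hlt : p.tail.length + q.tail.length < n := by
        rw [List.length_tail, List.length_tail]
        have : p.length ≠ 0 ∨ q.length ≠ 0 := by
          rw [Ne, List.length_eq_zero_iff, Ne, List.length_eq_zero_iff]; tauto
        omega
      obtain ⟨m, h1, h2⟩ := ih _ hlt _ _ rfl
      exact ⟨m + 1, by omega, StepsTo.head (by rw [hclear, if_neg h]) h2⟩

/-! ### Length estimates and the complete run -/

theorem length_digitsCode (l : List Bool) : (digitsCode l).length = 2 * l.length := by
  simp [digitsCode, mul_comm]

theorem length_layout_le (i : ℕ) (l : List Bool) : (layout i l).length ≤ 2 * l.length + 2 := by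
  rw [layout]
  split_ifs
  · rw [length_digitsCode]; omega
  · simp [length_digitsCode]; omega

theorem length_numCode (l : List (Option Bool)) : (numCode l).length = 2 * l.length := by
  induction l with
  | nil => rfl
  | cons o l ih => cases o <;> simp [numCode] at ih ⊢ <;> omega

theorem numCode_map_some (l : List Bool) : numCode (l.map some) = digitsCode l := by
  simp [numCode, digitsCode, List.flatMap_map]

theorem intCount_map_some (l : List Bool) (items : List (Option Bool)) :
    intCount false (l.map some ++ items) = l.length + intCount false items := by
  induction l with
  | nil => simp
  | cons b l ih => simp [intCount, ih]; ring

theorem intCount_true (items : List (Option Bool)) : intCount true items = 0 := by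
  induction items with
  | nil => rfl
  | cons o items ih => cases o <;> simp [intCount, ih]

theorem HasDigits.exists_numCode {d : Dyadic} {l l' : List Bool} (h : HasDigits d l l') :
    ∃ items, encode d = true :: true :: numCode items ∧ intCount false items = l.length ∧
      items.reduceOption = l ++ l' ∧ (l ++ l').length ≤ items.length := by
  rcases eq_or_ne l' [] with rfl | hne
  · refine ⟨l.map some, ?_, ?_, ?_, by simp⟩
    · rw [h.encode_eq, numCode_map_some]; simp [digitsCode]
    · simpa [intCount] using intCount_map_some l []
    · simp [List.reduceOption]
  · refine ⟨l.map some ++ none :: l'.map some, ?_, ?_, ?_, by simp⟩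
    · rw [h.encode_eq, if_neg hne]
      simp [numCode, digitsCode, List.flatMap_map]
    · rw [intCount_map_some, intCount, intCount_true, add_zero]
    · simp [List.reduceOption]

theorem stepsTo_contractRay (d : Ray 1) : ∃ n ≤ 5 * (encode d.1).length + 10,
    StepsTo n ⟨some .start, (none, none, false), stks (encode d.1) [] [] false [] []⟩
      ⟨none, (none, none, false), stks (encode (contractRay d)) [] [] false [] []⟩ := by
  obtain ⟨l, l', h⟩ := exists_hasDigits d.2
  obtain ⟨items, h1, h2, h3, h4⟩ := h.exists_numCode
  have hstart : StepsTo 1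
      ⟨some .start, (none, none, false), stks (encode d.1) [] [] false [] []⟩
      ⟨some (.run false), (none, none, false),
        workStks (numCode items) 1 [true] false [true] []⟩ := by
    refine StepsTo.head ?_ (StepsTo.refl _)
    rw [h1]
    simp [program, popFst, jump, workStks, layout, pending, digitsCode]
  -- The leading 1 is already read and written, so one digit has been read: `2 ^ 0 + 0 = 1`.
  obtain ⟨c, p, q, hpq, hrun⟩ := stepsTo_run items (g := false) (i := 1) (e := [true]) false
    (s := 0) (r := 0) (by norm_num) (by simp)
  have hpad := stepsTo_pad (1 + intCount false items)
    ([true] ++ contractDigits 0 0 items.reduceOption) c p q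
  have hlen := length_contractDigits_le 0 0 (l ++ l')
  rw [h2, h3] at hrun hpad
  have henc := encode_contractRay h
  generalize contractDigits 0 0 (l ++ l') = X at *
  have e1 : 1 + l.length - ([true] ++ X).length = l.length - X.length := by
    simp; omega
  rw [e1] at hpad
  rw [add_comm 1 l.length] at hpad hrun
  rw [← List.singleton_append, List.append_assoc] at henc
  rw [List.append_assoc, ← henc] at hpad
  have hout := stepsTo_out (encode (contractRay d)).reverse [] c p q
  rw [List.reverse_reverse, List.append_nil] at hout
  obtain ⟨n, hn, hclear⟩ := stepsTo_clear (encode (contractRay d)) c p q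
  refine ⟨_, ?_, (((hstart.trans hrun).trans hpad).trans hout).trans hclear⟩
  have hl1 : (encode (contractRay d)).length ≤ 2 * (1 + (X.length + (l.length - X.length))) + 2 := by
    rw [henc]
    refine (length_layout_le _ _).trans ?_
    simp
  have hl2 : (encode d.1).length = 2 * items.length + 2 := by
    rw [h1]; simp [length_numCode]
  rw [List.length_reverse, hl2]
  rw [List.length_append] at h4 hlen
  rw [pow_zero] at hpq
  omega

/-! ### The machine and polynomial time computability -/

/-- A Turing machine computing `contractRay`. -/
def machine : FinTM2 where
  K := Stk
  k₀ := .io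
  k₁ := .io
  Γ _ := Bool
  Λ := Lbl
  main := .start
  σ := Reg
  initialState := (none, none, false)
  Γk₀Fin := inferInstanceAs (Fintype Bool)
  m := program

theorem initList_machine (l : List Bool) :
    initList machine l = (⟨some .start, (none, none, false), stks l [] [] false [] []⟩ : Conf) := by
  unfold initList
  congr 1
  funext k
  rcases k with _ | _ | _ | b
  · rfl
  · rfl
  · rfl
  · cases b <;> rfl

theorem haltList_machine (l : List Bool) :
    haltList machine l = (⟨none, (none, none, false), stks l [] [] false [] []⟩ : Conf) := by
  unfold haltList
  congr 1
  funext k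
  rcases k with _ | _ | _ | b
  · rfl
  · rfl
  · rfl
  · cases b <;> rfl

theorem polyTimeComputable_contractRay : PolyTimeComputable contractRay := by
  choose n hn h using stepsTo_contractRay
  refine ⟨{ tm := machine, inputAlphabet := Equiv.refl Bool, outputAlphabet := Equiv.refl Bool,
            time := 5 * Polynomial.X + 10, outputsFun := fun d =>
              { steps := n d, evals_in_steps := ?_, steps_le_m := ?_ } }⟩
  · have e1 : List.map (Equiv.refl Bool).invFun (encode d.1) = encode d.1 := List.map_id _
    have e2 : List.map (Equiv.refl Bool).invFun (encode (contractRay d)) =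
      encode (contractRay d) := List.map_id _
    have h' := h d
    rw [← initList_machine, ← haltList_machine] at h'
    erw [e1, e2]
    exact h'
  · simpa using hn d

end DyadicComplexity

theorem mainTheorem2 :
    ∃ (a : Dyadic) (f : DyadicComplexity.Ray a → Dyadic),
      DyadicComplexity.PolyTimeComputable f ∧
      DyadicComplexity.IsContinuous f ∧
      ∀ m : ℕ → ℕ → ℕ, DyadicComplexity.IsModulus f m →
        (∀ n : ℕ, ¬ DyadicComplexity.PolyBounded (fun k => m k n)) ∧
        (∀ k : ℕ, ¬ DyadicComplexity.PolyBounded (fun n => m k n)) :=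
  ⟨1, DyadicComplexity.contractRay, DyadicComplexity.polyTimeComputable_contractRay,
    DyadicComplexity.isContinuous_contractRay,
    fun _ hm => DyadicComplexity.not_polyBounded_modulus hm⟩
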